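/- **Setting.** Let $Q^*=\{q_1,\dots,q_M\}$ be a finite benchmark, $(\mathcal F,d_{\mathcal F})$ a (pseudo)metric space of models with a $\sigma$-algebra containing the open sets, $P_f$ a probability measure on $\mathcal F$, and $y:\mathcal F\times 2^{Q^*}\to[0,1]$ a score, measurable in the model. For each $q_j$ the response of $f$ to $q_j$ has a law that depends measurably on $f$; $g$ is a fixed measurable embedding of responses into $\mathbb R^p$, and the embedded response $g(f(q_j))$ has a finite second moment for all $f,j$. Random models $f,f_1,f_2,\dots$ are i.i.d. from $P_f$; given the models, all responses are independent, with $r$ responses per model and query. For $Q\subseteq Q^*$ and a collection of $n$ models let $\bar X_i$ be the matrix with a row for each $q_j\in Q$, namely the average of the $r$ embedded responses of the $i$-th model to $q_j$. *Estimated perspectives* (DKPS representations) $\widehat\psi_i\in\mathbb R^d$ of the collection are any minimizer of $\sum_{i,i'}(\|z_i-z_{i'}\|-D_{ii'})^2$ over $z_1,\dots,z_n\in\mathbb R^d$, with $D_{ii'}=\|\bar X_i-\bar X_{i'}\|_F$ (chosen measurably in the data). *True perspectives* $\psi_i(Q)\in\mathbb R^d$ of the collection are any minimizer of the same expression with every average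 embedded response replaced by its expectation $\mathbb E[g(f_i(q_j))]$. Given $n$ reference models with responses and a target $f$ with responses, estimated perspectives $\widehat\psi,\widehat\psi_1,\dots,\widehat\psi_n$ of the target and the reference models are computed together, and $\hat y_{NN}$ is the average of the scores $y(f_i,Q^*)$ over all $i$ that attain $\min_k\|\widehat\psi_k-\widehat\psi\|_2$. The subset score is $\hat y_Q=y(f,Q)$. For an estimator $\hat y$, $\mathrm{MSE}(\hat y)=\mathbb E[(\hat y-y(f,Q^*))^2]$, where the expectation is over the target $f\sim P_f$ and its responses, given the reference data. A statement about $(n,r)$ and the reference data holds *with high probability* if for every $\eta>0$ there is $N$ such that for every $n>N$ there is $R$ such that for all $r\ge R$ it fails with probability at most $\eta$. **Assumption 1 for $Q$.** There is $\gamma>0$ such that $|y(f,Q^*)-y(f',Q^*)|\le\gamma\|\psi(Q)-\psi'(Q)\|_2$ for all true perspectives $\psi(Q),\psi'(Q)$ of models $f,f'$ in any finite collection. **Assumption 2 for $Q$.** $P_f(\{f':d_{\mathcal F}(f,f')<\delta\})>0$ for all $f\in\mathcal F$, $\delta>0$; and $d_{\mathcal F}$ is appropriate for the perspective space: for every $f$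 and $\varepsilon'>0$ there is $\delta>0$ such that $d_{\mathcal F}(f,f')<\delta$ implies $\|\psi(Q)-\psi'(Q)\|_2<\varepsilon'$ for all true perspectives of $f$ and $f'$ in any finite collection that contains both. **Theorem.** 1. If $Q\subseteq Q^*$ satisfies Assumptions 1 and 2, then for every $\varepsilon>0$, $\mathrm{MSE}(\hat y_{NN})\le\varepsilon$ with high probability. In particular, for $m=|Q|$ and any prescribed failure probability there are $n$ and $r$ for which the bound holds. 2. If moreover $\mathrm{MSE}(\hat y_Q)>0$, then $\hat y_{NN}$ is $Q$-query-efficient relative to $\hat y_Q$ with high probability: $\mathrm{MSE}(\hat y_{NN})\le\mathrm{MSE}(\hat y_Q)$ with high probability. 3. Consequently, if $m<M$ and every $Q$ with $|Q|=m$ satisfies Assumptions 1 and 2 and $\mathrm{MSE}(\hat y_Q)>0$, then $\hat y_{NN}$ is $m$-query-efficient relative to $\hat y_Q$ with high probability (the conclusion of 2 holds for all $Q$ with $|Q|=m$); and if this is so for all $1\le m<M$, then $\hat y_{NN}$ is query-efficient relative to $\hat y_Q$ with high probability (it is $m$-query-efficient for all $1\le m<M$). -/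

import Mathlib

open MeasureTheory ProbabilityTheory

noncomputable section

namespace DKPS

/-- A benchmark of `M` queries (the full query set `Q*` is indexed by `Fin M`), a space `F` of
models with the law `modelLaw` (`P_f`), the response distributions of a model to each query, a
fixed embedding of responses into `ℝ^p`, and a `[0,1]`-valued score of every model on every subset
of the queries. -/
structure Setting (F X : Type*) [MeasurableSpace F] [MeasurableSpace X] (M p : ℕ) where
  modelLaw : Measure F
  modelLaw_prob : IsProbabilityMeasure modelLaw
  /-- `response j f` is the law of the (random) response of the model `f` to the query `j`. -/
  response : Fin M → Kernel F X
  response_markov : ∀ j, IsMarkovKernel (response j)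
  embed : X → EuclideanSpace ℝ (Fin p)
  embed_measurable : Measurable embed
  score : F → Finset (Fin M) → ℝ
  score_mem : ∀ f Q, score f Q ∈ Set.Icc (0 : ℝ) 1
  score_measurable : ∀ Q, Measurable fun f => score f Q

attribute [instance] Setting.modelLaw_prob Setting.response_markov

/-- A model together with `r` cached responses to each of the `M` queries. -/
abbrev Draw (F X : Type*) (M r : ℕ) : Type _ := F × (Fin M × Fin r → X)

section Multidimensional

variable {ι : Type*} [Fintype ι] {d : ℕ}

/-- The raw stress of a configuration `z` of points of `ℝ^d` for the dissimilarities `D`. -/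
def stress (D : ι → ι → ℝ) (z : ι → EuclideanSpace ℝ (Fin d)) : ℝ :=
  ∑ i, ∑ i', (‖z i - z i'‖ - D i i') ^ 2

/-- `z` is a solution of the multidimensional scaling problem for `D` in `ℝ^d`. -/
def IsStressMinimizer (D : ι → ι → ℝ) (z : ι → EuclideanSpace ℝ (Fin d)) : Prop :=
  ∀ z' : ι → EuclideanSpace ℝ (Fin d), stress D z ≤ stress D z'

end Multidimensional

/-- Frobenius distance between two matrices whose rows are indexed by the queries, restricted to
the rows in `Q`. -/
def frobDist {M p : ℕ} (Q : Finset (Fin M)) (A B : Fin M → EuclideanSpace ℝ (Fin p)) : ℝ :=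
  Real.sqrt (∑ j ∈ Q, ‖A j - B j‖ ^ 2)

/-- Nearest-neighbour regression: index `0` is the target, the indices `i.succ` are the reference
models with scores `y i`; the scores of all nearest neighbours are averaged. -/
def nnPredict {n d : ℕ} (z : Fin (n + 1) → EuclideanSpace ℝ (Fin d)) (y : Fin n → ℝ) : ℝ :=
  open Classical in
  (∑ i : Fin n, if ‖z i.succ - z 0‖ = ⨅ k : Fin n, ‖z k.succ - z 0‖ then y i else 0) /
    (∑ i : Fin n, if ‖z i.succ - z 0‖ = ⨅ k : Fin n, ‖z k.succ - z 0‖ then 1 else 0)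

namespace Setting

variable {F X : Type*} [MeasurableSpace F] [MeasurableSpace X] {M p : ℕ} (S : Setting F X M p)

/-- Given a model, its `r` responses to each query are independent, those to query `j` having the
law `response j f`. -/
def responseKernel (r : ℕ) : Kernel F (Fin M × Fin r → X) where
  toFun f := Measure.pi fun jk : Fin M × Fin r => S.response jk.1 f
  measurable' := by
    refine Measurable.measure_of_isPiSystem_of_isProbabilityMeasure generateFrom_pi.symm
      isPiSystem_pi ?_
    rintro _ ⟨s, hs, rfl⟩
    simp only [Measure.pi_pi]
    exact Finset.measurable_prod _ fun jk _ =>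
      (S.response jk.1).measurable_coe (hs jk (Set.mem_univ jk))

/-- The joint law of a random model and its responses. -/
def drawLaw (r : ℕ) : Measure (Draw F X M r) := S.modelLaw ⊗ₘ S.responseKernel r

/-- The law of `n` independent reference models with their responses. -/
def trainLaw (n r : ℕ) : Measure (Fin n → Draw F X M r) := Measure.pi fun _ => S.drawLaw r

/-- Average embedded responses of a model, one row for each query. -/
def meanResponse {r : ℕ} (x : Draw F X M r) : Fin M → EuclideanSpace ℝ (Fin p) :=
  fun j => (r : ℝ)⁻¹ • ∑ k : Fin r, S.embed (x.2 (j, k))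

/-- Expected embedded responses of a model, one row for each query. -/
def expResponse (f : F) : Fin M → EuclideanSpace ℝ (Fin p) :=
  fun j => ∫ x, S.embed x ∂(S.response j f)

/-- The estimated dissimilarities of a finite collection, from the responses to `Q`. -/
def estDist {ι : Type*} {r : ℕ} (Q : Finset (Fin M)) (x : ι → Draw F X M r) : ι → ι → ℝ :=
  fun i i' => frobDist Q (S.meanResponse (x i)) (S.meanResponse (x i'))

/-- The population dissimilarities of a finite collection of models under `Q`. -/
def popDist {ι : Type*} (Q : Finset (Fin M)) (c : ι → F) : ι → ι → ℝ :=
  fun i i' => frobDist Q (S.expResponse (c i)) (S.expResponse (c i'))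

/-- `ψ` are true `d`-dimensional perspectives of the collection `c` under `Q`: a solution of the
scaling problem with every average response replaced by its expectation. -/
def IsTruePerspective {d n : ℕ} (Q : Finset (Fin M)) (c : Fin n → F)
    (ψ : Fin n → EuclideanSpace ℝ (Fin d)) : Prop :=
  IsStressMinimizer (S.popDist Q c) ψ

/-- `psiHat` computes, measurably in the data, estimated `d`-dimensional perspectives under every
query set; any solution of the scaling problem may be chosen. -/
def IsDKPS {d : ℕ} (psiHat : Finset (Fin M) → ∀ n r : ℕ,
    (Fin n → Draw F X M r) → Fin n → EuclideanSpace ℝ (Fin d)) : Prop :=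
  ∀ Q n r, Measurable (psiHat Q n r) ∧ ∀ x, IsStressMinimizer (S.estDist Q x) (psiHat Q n r x)

/-- Every embedded response distribution has a finite second moment. -/
def FiniteSecondMoment : Prop := ∀ f j, MemLp S.embed 2 (S.response j f)

/-- The full benchmark score is `γ`-Lipschitz on the `d`-dimensional perspective space induced by
`Q`, for some `γ > 0`. -/
def LipschitzScore (d : ℕ) (Q : Finset (Fin M)) : Prop :=
  ∃ γ : ℝ, 0 < γ ∧ ∀ (n : ℕ) (c : Fin n → F) (ψ : Fin n → EuclideanSpace ℝ (Fin d)),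
    S.IsTruePerspective Q c ψ → ∀ i i',
      |S.score (c i) Finset.univ - S.score (c i') Finset.univ| ≤ γ * ‖ψ i - ψ i'‖

/-- Every ball of the model space has positive mass. -/
def FullSupport [PseudoMetricSpace F] : Prop :=
  ∀ (f : F) (δ : ℝ), 0 < δ → ∃ ε : ℝ, 0 < ε ∧ ε ≤ S.modelLaw.real (Metric.ball f δ)

/-- The distance on models is appropriate for the perspective space induced by `Q`: models close
to `f` have true perspectives close to that of `f`. -/
def PerspectiveContinuous [PseudoMetricSpace F] (d : ℕ) (Q : Finset (Fin M)) : Prop :=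
  ∀ (f : F) (ε : ℝ), 0 < ε → ∃ δ : ℝ, 0 < δ ∧ ∀ f' : F, dist f f' < δ →
    ∀ (n : ℕ) (c : Fin n → F) (ψ : Fin n → EuclideanSpace ℝ (Fin d)),
      S.IsTruePerspective Q c ψ → ∀ i i', c i = f → c i' = f' → ‖ψ i - ψ i'‖ < ε

end Setting

/-- A sequence of decision functions (for every number `n` of reference models and `r` of
responses): the prediction for a target from the reference data and the target's data. -/
abbrev Predictor (F X : Type*) (M : ℕ) : Type _ :=
  ∀ n r : ℕ, (Fin n → Draw F X M r) → Draw F X M r → ℝ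

def sqLoss (a b : ℝ) : ℝ := (a - b) ^ 2

namespace Setting

variable {F X : Type*} [MeasurableSpace F] [MeasurableSpace X] {M p : ℕ} (S : Setting F X M p)

/-- The expected loss of a predictor over a random target, given the reference data `s`. -/
def risk (ℓ : ℝ → ℝ → ℝ) (h : Predictor F X M) {n r : ℕ} (s : Fin n → Draw F X M r) : ℝ :=
  ∫ t, ℓ (h n r s t) (S.score t.1 Finset.univ) ∂(S.drawLaw r)

/-- The subset-score estimator, which does not use the reference data. -/
def subsetPredictor (Q : Finset (Fin M)) : Predictor F X M := fun _ _ _ t => S.score t.1 Q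

/-- Nearest-neighbour regression on estimated perspectives, which are computed for the target
(index `0`) and the reference models together. -/
def nnPredictor {d : ℕ} (psiHat : Finset (Fin M) → ∀ n r : ℕ,
    (Fin n → Draw F X M r) → Fin n → EuclideanSpace ℝ (Fin d)) (Q : Finset (Fin M)) :
    Predictor F X M :=
  fun n r s t => nnPredict (psiHat Q (n + 1) r (Fin.cons t s))
    fun i => S.score (s i).1 Finset.univ

/-- With high probability over the reference data, for all large `n` and all `r` that are large
depending on `n`: the failure probability of `E` is eventually below every `η > 0`. -/
def WithHighProbability (E : ∀ n r : ℕ, (Fin n → Draw F X M r) → Prop) : Prop :=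
  ∀ η : ℝ, 0 < η → ∃ N : ℕ, ∀ n, N < n → ∃ R : ℕ, ∀ r, R ≤ r →
    (S.trainLaw n r).real {s | ¬ E n r s} ≤ η

/-- With high probability, `h` is query-efficient relative to `h'` for a fixed query set. -/
def QEfficient (ℓ : ℝ → ℝ → ℝ) (h h' : Predictor F X M) : Prop :=
  S.WithHighProbability fun _ _ s => S.risk ℓ h s ≤ S.risk ℓ h' s

/-- The same for all query sets of size `m`. -/
def MEfficient (ℓ : ℝ → ℝ → ℝ) (m : ℕ) (h h' : Finset (Fin M) → Predictor F X M) : Prop :=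
  ∀ Q, Q.card = m → S.QEfficient ℓ (h Q) (h' Q)

/-- The same for all query budgets `1 ≤ m < M`. -/
def QueryEfficient (ℓ : ℝ → ℝ → ℝ) (h h' : Finset (Fin M) → Predictor F X M) : Prop :=
  ∀ m, 1 ≤ m → m < M → S.MEfficient ℓ m h h'

/-- The mean squared error of the subset score over the model distribution. -/
def subsetMSE (Q : Finset (Fin M)) : ℝ :=
  ∫ f, (S.score f Q - S.score f Finset.univ) ^ 2 ∂S.modelLaw

end Setting

end DKPS

end

/-!
Call a target together with its reference models misleading if, in some scaling solution, a
nearest neighbour of the target has a score that differs from the target's by more than `τ`. By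
the Lipschitz property such a nearest neighbour is far away, hence by continuity every reference
model is at least some `δ > 0` from the target, which has vanishing probability as `n → ∞` because
all balls have positive mass. For a fixed collection that is not misleading, compactness of the
centred scaling solutions shows that this persists for all dissimilarities close to the population
ones, and the strong law of large numbers brings the estimated dissimilarities there as `r → ∞`.
The nearest neighbour prediction is off by at most `τ` on data that are not misleading and by at
most `1` otherwise; Markov's inequality turns the expected risk into a bound with high
probability.
-/

open Filter Topology

namespace DKPS

section Multidimensional

variable {ι : Type*} [Fintype ι] {d : ℕ}

theorem continuous_stress :
    Continuous fun q : (ι → ι → ℝ) × (ι → EuclideanSpace ℝ (Fin d)) => stress q.1 q.2 := by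
  unfold stress
  fun_prop

theorem continuous_stress_left (z : ι → EuclideanSpace ℝ (Fin d)) :
    Continuous fun D : ι → ι → ℝ => stress D z := by
  unfold stress
  fun_prop

theorem isClosed_setOf_isStressMinimizer :
    IsClosed {q : (ι → ι → ℝ) × (ι → EuclideanSpace ℝ (Fin d)) |
      IsStressMinimizer q.1 q.2} := by
  simp only [IsStressMinimizer, Set.ofPred_forall]
  exact isClosed_iInter fun z' =>
    isClosed_le continuous_stress ((continuous_stress_left z').comp continuous_fst)

variable {D : ι → ι → ℝ} {z : ι → EuclideanSpace ℝ (Fin d)}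

theorem IsStressMinimizer.sub_const (hz : IsStressMinimizer D z) (v : EuclideanSpace ℝ (Fin d)) :
    IsStressMinimizer D fun i => z i - v := fun z' => by
  have hinv : stress D (fun i => z i - v) = stress D z := by
    simp only [stress, sub_sub_sub_cancel_right]
  exact hinv.trans_le (hz z')

theorem sq_norm_sub_sub_le_stress (D : ι → ι → ℝ) (z : ι → EuclideanSpace ℝ (Fin d)) (i i' : ι) :
    (‖z i - z i'‖ - D i i') ^ 2 ≤ stress D z :=
  calc (‖z i - z i'‖ - D i i') ^ 2 ≤ ∑ k, (‖z i - z k‖ - D i k) ^ 2 :=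
        Finset.single_le_sum (f := fun k => (‖z i - z k‖ - D i k) ^ 2)
          (fun _ _ => sq_nonneg _) (Finset.mem_univ i')
    _ ≤ stress D z :=
        Finset.single_le_sum (f := fun l => ∑ k, (‖z l - z k‖ - D l k) ^ 2)
          (fun _ _ => Finset.sum_nonneg fun _ _ => sq_nonneg _) (Finset.mem_univ i)

theorem IsStressMinimizer.norm_le (hz : IsStressMinimizer D z) {i₀ : ι} (hz₀ : z i₀ = 0) :
    ‖z‖ ≤ ‖D‖ + √(stress D (0 : ι → EuclideanSpace ℝ (Fin d))) := by
  refine (pi_norm_le_iff_of_nonneg (by positivity)).2 fun i => ?_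
  have hdev : ‖z i - z i₀‖ - D i i₀ ≤ √(stress D (0 : ι → EuclideanSpace ℝ (Fin d))) :=
    Real.le_sqrt_of_sq_le ((sq_norm_sub_sub_le_stress D z i i₀).trans (hz 0))
  have hD : D i i₀ ≤ ‖D‖ :=
    (Real.le_norm_self _).trans ((norm_le_pi_norm (D i) i₀).trans (norm_le_pi_norm D i))
  rw [hz₀, sub_zero] at hdev
  linarith

-- Minimizers centred at a point are bounded locally uniformly in the dissimilarities, so limits of
-- dissimilarities come with limits of their minimizers.
theorem isClosed_setOf_exists_isStressMinimizer [Nonempty ι]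
    {P : (ι → EuclideanSpace ℝ (Fin d)) → Prop} (hP : IsClosed {z | P z})
    (hsub : ∀ z, P z → ∀ v, P fun i => z i - v) :
    IsClosed {D : ι → ι → ℝ | ∃ z, P z ∧ IsStressMinimizer D z} := by
  refine IsSeqClosed.isClosed fun D D₀ hD hlim => ?_
  let i₀ : ι := Classical.arbitrary ι
  have hcentred (k : ℕ) : ∃ z, P z ∧ IsStressMinimizer (D k) z ∧ z i₀ = 0 := by
    obtain ⟨z, hzP, hz⟩ := hD k
    exact ⟨_, hsub z hzP (z i₀), hz.sub_const (z i₀), sub_self _⟩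
  choose z hzP hz hz₀ using hcentred
  have hcont : Continuous fun D : ι → ι → ℝ =>
      ‖D‖ + √(stress D (0 : ι → EuclideanSpace ℝ (Fin d))) :=
    continuous_norm.add (continuous_stress_left 0).sqrt
  obtain ⟨C, hC⟩ := ((hcont.tendsto D₀).comp hlim).bddAbove_range
  have hball (k : ℕ) : z k ∈ Metric.closedBall (0 : ι → EuclideanSpace ℝ (Fin d)) C :=
    mem_closedBall_zero_iff.2 (((hz k).norm_le (hz₀ k)).trans (hC (Set.mem_range_self k)))
  obtain ⟨a, -, φ, hφ, ha⟩ := tendsto_subseq_of_bounded Metric.isBounded_closedBall hball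
  have haP : P a := hP.mem_of_tendsto ha (Eventually.of_forall fun k => hzP (φ k))
  have hpair : Tendsto (fun k => (D (φ k), z (φ k))) atTop (𝓝 (D₀, a)) :=
    (hlim.comp hφ.tendsto_atTop).prodMk_nhds ha
  have hmin : (D₀, a) ∈ {q : (ι → ι → ℝ) × (ι → EuclideanSpace ℝ (Fin d)) |
      IsStressMinimizer q.1 q.2} :=
    isClosed_setOf_isStressMinimizer.mem_of_tendsto hpair (Eventually.of_forall fun k => hz (φ k))
  exact ⟨a, haP, hmin⟩

end Multidimensional

section NearestNeighbour

variable {n d : ℕ}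

/-- The reference point `i.succ` is a nearest neighbour of the target, which has index `0`. -/
def IsNearest (z : Fin (n + 1) → EuclideanSpace ℝ (Fin d)) (i : Fin n) : Prop :=
  ∀ k : Fin n, ‖z i.succ - z 0‖ ≤ ‖z k.succ - z 0‖

theorem isNearest_iff_eq_iInf {z : Fin (n + 1) → EuclideanSpace ℝ (Fin d)} {i : Fin n} :
    IsNearest z i ↔ ‖z i.succ - z 0‖ = ⨅ k : Fin n, ‖z k.succ - z 0‖ := by
  have : Nonempty (Fin n) := ⟨i⟩
  have hbdd : BddBelow (Set.range fun k : Fin n => ‖z k.succ - z 0‖) :=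
    (Set.finite_range _).bddBelow
  exact ⟨fun h => le_antisymm (le_ciInf h) (ciInf_le hbdd i), fun h k => h ▸ ciInf_le hbdd k⟩

theorem nnPredict_mem {s : Set ℝ} (hs : Convex ℝ s) (hn : 0 < n)
    {z : Fin (n + 1) → EuclideanSpace ℝ (Fin d)} {y : Fin n → ℝ}
    (h : ∀ i, IsNearest z i → y i ∈ s) : nnPredict z y ∈ s := by
  classical
  have : Nonempty (Fin n) := ⟨⟨0, hn⟩⟩
  obtain ⟨i₀, hi₀⟩ := Finite.exists_min fun k : Fin n => ‖z k.succ - z 0‖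
  have hmean : nnPredict z y =
      (Finset.univ.filter fun i => IsNearest z i).centerMass (fun _ => (1 : ℝ)) y := by
    simp only [nnPredict, ← isNearest_iff_eq_iInf, ← Finset.sum_filter, Finset.centerMass,
      one_mul, smul_eq_mul, div_eq_inv_mul]
  rw [hmean]
  refine hs.centerMass_mem (fun _ _ => zero_le_one)
    (Finset.sum_pos (fun _ _ => one_pos) ⟨i₀, ?_⟩) fun i hi => h i (Finset.mem_filter.1 hi).2
  exact Finset.mem_filter.2 ⟨Finset.mem_univ _, hi₀⟩

theorem isClosed_setOf_isNearest (i : Fin n) :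
    IsClosed {z : Fin (n + 1) → EuclideanSpace ℝ (Fin d) | IsNearest z i} := by
  simp only [IsNearest, Set.ofPred_forall]
  exact isClosed_iInter fun k => isClosed_le (by fun_prop) (by fun_prop)

theorem isClosed_setOf_exists_isStressMinimizer_isNearest (d : ℕ) (i : Fin n) :
    IsClosed {D : Fin (n + 1) → Fin (n + 1) → ℝ |
      ∃ z : Fin (n + 1) → EuclideanSpace ℝ (Fin d), IsNearest z i ∧ IsStressMinimizer D z} :=
  isClosed_setOf_exists_isStressMinimizer (isClosed_setOf_isNearest i) fun z hz v => by
    simpa only [IsNearest, sub_sub_sub_cancel_right] using hz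

/-- Dissimilarities `D` and scores `y` of a target (index `0`) and `n` reference points are
misleading at tolerance `τ` if in some `d`-dimensional scaling solution for `D` the target has a
nearest neighbour whose score is not within `τ` of that of the target. Quantifying over all
solutions makes the notion independent of how one of them is chosen, and closed in `D`. -/
def IsMisleading (d : ℕ) (τ : ℝ) (D : Fin (n + 1) → Fin (n + 1) → ℝ) (y : Fin (n + 1) → ℝ) :
    Prop :=
  ∃ i : Fin n, (∃ z : Fin (n + 1) → EuclideanSpace ℝ (Fin d),
    IsNearest z i ∧ IsStressMinimizer D z) ∧ τ < |y i.succ - y 0|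

theorem isClosed_setOf_isMisleading (d : ℕ) (τ : ℝ) (y : Fin (n + 1) → ℝ) :
    IsClosed {D | IsMisleading d τ D y} := by
  simp only [IsMisleading, Set.ofPred_exists]
  exact isClosed_iUnion_of_finite fun i =>
    (isClosed_setOf_exists_isStressMinimizer_isNearest d i).inter isClosed_const

theorem measurableSet_setOf_isMisleading (d : ℕ) (τ : ℝ) :
    MeasurableSet {q : (Fin (n + 1) → Fin (n + 1) → ℝ) × (Fin (n + 1) → ℝ) |
      IsMisleading d τ q.1 q.2} := by
  simp only [IsMisleading, Set.ofPred_exists]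
  refine MeasurableSet.iUnion fun i => MeasurableSet.inter
    (measurable_fst (isClosed_setOf_exists_isStressMinimizer_isNearest d i).measurableSet) ?_
  have hdiff : Measurable fun q : (Fin (n + 1) → Fin (n + 1) → ℝ) × (Fin (n + 1) → ℝ) =>
      |q.2 i.succ - q.2 0| := by
    fun_prop
  exact measurableSet_lt measurable_const hdiff

theorem abs_nnPredict_sub_le_of_not_isMisleading (hn : 0 < n) {τ : ℝ}
    {D : Fin (n + 1) → Fin (n + 1) → ℝ} {y : Fin (n + 1) → ℝ} (h : ¬ IsMisleading d τ D y)
    {z : Fin (n + 1) → EuclideanSpace ℝ (Fin d)} (hz : IsStressMinimizer D z) :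
    |nnPredict z (fun i => y i.succ) - y 0| ≤ τ :=
  nnPredict_mem (convex_closedBall (y 0) τ) hn fun i hi =>
    not_lt.1 fun hlt => h ⟨i, ⟨z, hi, hz⟩, hlt⟩

end NearestNeighbour

theorem continuous_frobDist {ι : Type*} {M p : ℕ} (Q : Finset (Fin M)) :
    Continuous fun (A : ι → Fin M → EuclideanSpace ℝ (Fin p)) (i i' : ι) =>
      frobDist Q (A i) (A i') :=
  continuous_pi fun i => continuous_pi fun i' => (continuous_finsetSum _ fun j _ =>
    ((continuous_apply_apply i j).sub (continuous_apply_apply i' j)).norm.pow 2).sqrt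

section ProductMeasure

variable {ι : Type*} {α β : ι → Type*} [∀ i, MeasurableSpace (α i)] [∀ i, MeasurableSpace (β i)]

theorem measurePreserving_infinitePi_comp (μ : ∀ i, Measure (α i)) [∀ i, IsProbabilityMeasure (μ i)]
    {κ : Type*} [Fintype κ] {e : κ → ι} (he : Function.Injective e) :
    MeasurePreserving (fun (ω : ∀ i, α i) k => ω (e k)) (Measure.infinitePi μ)
      (Measure.pi fun k => μ (e k)) where
  measurable := by fun_prop
  map_eq := by
    have hindep : iIndepFun (fun k (ω : ∀ i, α i) => ω (e k)) (Measure.infinitePi μ) :=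
      (iIndepFun_infinitePi (X := fun _ => id) fun _ => measurable_id).precomp he
    rw [(iIndepFun_iff_map_fun_eq_pi_map fun k =>
      (measurable_pi_apply (e k)).aemeasurable).1 hindep]
    exact congrArg Measure.pi (funext fun k => Measure.infinitePi_map_eval μ (e k))

variable [Fintype ι]

theorem measure_pi_exists_mem_le (μ : ∀ i, Measure (α i)) [∀ i, IsProbabilityMeasure (μ i)]
    (s : ∀ i, Set (α i)) : Measure.pi μ {x | ∃ i, x i ∈ s i} ≤ ∑ i, μ i (s i) := by
  rw [Set.ofPred_exists]
  refine (measure_iUnion_fintype_le _ _).trans (Finset.sum_le_sum fun i _ => ?_)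
  exact (Measure.le_map_apply (measurable_pi_apply i).aemeasurable (s i)).trans_eq
    (by rw [← (measurePreserving_eval μ i).map_eq])

theorem lintegral_pi_prod (μ : ∀ i, Measure (α i)) [∀ i, IsProbabilityMeasure (μ i)]
    {f : ∀ i, α i → ENNReal} (hf : ∀ i, Measurable (f i)) :
    ∫⁻ c, ∏ i, f i (c i) ∂(Measure.pi μ) = ∏ i, ∫⁻ a, f i a ∂(μ i) := by
  rw [lintegral_prod_eq_prod_lintegral_of_indepFun Finset.univ (fun i (c : ∀ i, α i) => f i (c i))
    (iIndepFun_pi fun i => (hf i).aemeasurable) fun i => (hf i).comp (measurable_pi_apply i)]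
  exact Finset.prod_congr rfl fun i _ => (measurePreserving_eval μ i).lintegral_comp (hf i)

/-- The product kernel, which applies `κ i` to the coordinate `i`, independently for all `i`. -/
noncomputable def piKernel (κ : ∀ i, Kernel (α i) (β i)) [∀ i, IsMarkovKernel (κ i)] :
    Kernel (∀ i, α i) (∀ i, β i) where
  toFun c := Measure.pi fun i => κ i (c i)
  measurable' := by
    refine Measurable.measure_of_isPiSystem_of_isProbabilityMeasure generateFrom_pi.symm
      isPiSystem_pi ?_
    rintro _ ⟨s, hs, rfl⟩
    simp only [Measure.pi_pi]
    exact Finset.measurable_prod _ fun i _ =>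
      ((κ i).measurable_coe (hs i (Set.mem_univ i))).comp (measurable_pi_apply i)

variable (κ : ∀ i, Kernel (α i) (β i)) [∀ i, IsMarkovKernel (κ i)]

theorem piKernel_apply (c : ∀ i, α i) : piKernel κ c = Measure.pi fun i => κ i (c i) := rfl

instance : IsMarkovKernel (piKernel κ) :=
  ⟨fun c => by rw [piKernel_apply]; infer_instance⟩

theorem measurePreserving_pi_compProd (μ : ∀ i, Measure (α i)) [∀ i, IsProbabilityMeasure (μ i)] :
    MeasurePreserving (fun (q : (∀ i, α i) × (∀ i, β i)) i => (q.1 i, q.2 i))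
      (Measure.pi μ ⊗ₘ piKernel κ) (Measure.pi fun i => μ i ⊗ₘ κ i) where
  measurable := by fun_prop
  map_eq := by
    have hmeas : Measurable fun (q : (∀ i, α i) × (∀ i, β i)) i => (q.1 i, q.2 i) := by fun_prop
    refine (Measure.pi_eq fun s hs => ?_).symm
    have hs' := MeasurableSet.univ_pi hs
    have hsection (c : ∀ i, α i) : piKernel κ c (Prod.mk c ⁻¹'
        ((fun (q : (∀ i, α i) × (∀ i, β i)) i => (q.1 i, q.2 i)) ⁻¹' Set.univ.pi s)) =
        ∏ i, κ i (c i) (Prod.mk (c i) ⁻¹' s i) := by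
      rw [piKernel_apply, ← Measure.pi_pi]
      rfl
    simp_rw [Measure.map_apply hmeas hs', Measure.compProd_apply (hmeas hs'), hsection]
    rw [lintegral_pi_prod μ fun i => Kernel.measurable_kernel_prodMk_left (hs i)]
    exact Finset.prod_congr rfl fun i _ => (Measure.compProd_apply (hs i)).symm

theorem measurePreserving_finCons {n : ℕ} {α : Fin (n + 1) → Type*} [∀ i, MeasurableSpace (α i)]
    (μ : ∀ i, Measure (α i)) [∀ i, SigmaFinite (μ i)] :
    MeasurePreserving (fun q : α 0 × (∀ i : Fin n, α i.succ) => (Fin.cons q.1 q.2 : ∀ i, α i))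
      ((μ 0).prod (Measure.pi fun i : Fin n => μ i.succ)) (Measure.pi μ) := by
  have hcons : (fun q : α 0 × (∀ i : Fin n, α i.succ) => (Fin.cons q.1 q.2 : ∀ i, α i)) =
      (MeasurableEquiv.piFinSuccAbove α 0).symm := by
    funext q
    exact (Fin.insertNth_zero (α := α) q.1 q.2).symm
  exact hcons ▸ (measurePreserving_piFinSuccAbove μ 0).symm

end ProductMeasure

section SampleMean

variable {ι X E : Type*} [MeasurableSpace X] [NormedAddCommGroup E] [NormedSpace ℝ E]
  [CompleteSpace E] [MeasurableSpace E] [BorelSpace E]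

theorem ae_tendsto_average_infinitePi (ν : ι → Measure X) [∀ j, IsProbabilityMeasure (ν j)]
    (j : ι) {g : X → E} (hg : Measurable g) (hint : Integrable g (ν j)) :
    ∀ᵐ ω ∂(Measure.infinitePi fun jk : ι × ℕ => ν jk.1),
      Tendsto (fun r : ℕ => (r : ℝ)⁻¹ • ∑ k : Fin r, g (ω (j, k))) atTop
        (𝓝 (∫ x, g x ∂(ν j))) := by
  let P := Measure.infinitePi fun jk : ι × ℕ => ν jk.1
  let Y : ℕ → (ι × ℕ → X) → E := fun k ω => g (ω (j, k))
  have heval (k : ℕ) : MeasurePreserving (fun ω : ι × ℕ → X => ω (j, k)) P (ν j) :=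
    measurePreserving_eval_infinitePi (fun jk : ι × ℕ => ν jk.1) (j, k)
  have hindep : iIndepFun Y P :=
    (iIndepFun_infinitePi (X := fun _ => g) fun _ => hg).precomp (Prod.mk_right_injective j)
  have hident (k : ℕ) : IdentDistrib (Y k) (Y 0) P P :=
    IdentDistrib.comp ⟨(heval k).aemeasurable, (heval 0).aemeasurable,
      (heval k).map_eq.trans (heval 0).map_eq.symm⟩ hg
  have hlaw := strong_law_ae Y ((heval 0).integrable_comp_of_integrable hint)
    (fun k k' hk => hindep.indepFun hk) hident
  have hmean : ∫ ω, Y 0 ω ∂P = ∫ x, g x ∂(ν j) := by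
    rw [← (heval 0).map_eq] at hint ⊢
    exact (integral_map (heval 0).aemeasurable hint.aestronglyMeasurable).symm
  simpa only [hmean, Finset.sum_range] using hlaw

end SampleMean

namespace Setting

variable {F X : Type*} [MeasurableSpace F] [MeasurableSpace X] {M p : ℕ} (S : Setting F X M p)

theorem responseKernel_apply (r : ℕ) (f : F) :
    S.responseKernel r f = Measure.pi fun jk : Fin M × Fin r => S.response jk.1 f := rfl

instance (r : ℕ) : IsMarkovKernel (S.responseKernel r) :=
  ⟨fun f => by rw [responseKernel_apply]; infer_instance⟩

instance (r : ℕ) : IsProbabilityMeasure (S.drawLaw r) := by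
  unfold drawLaw
  infer_instance

section Misleading

variable (d : ℕ) (Q : Finset (Fin M)) (τ : ℝ) (n : ℕ)

/-- The collections of models, target first, in which the population dissimilarities under `Q`
mislead nearest-neighbour regression on `d`-dimensional perspectives by more than `τ`. -/
def misleadingModels : Set (Fin (n + 1) → F) :=
  {c | IsMisleading d τ (S.popDist Q c) fun i => S.score (c i) Finset.univ}

/-- The collections of models with their responses, target first, in which the estimated
dissimilarities under `Q` mislead nearest-neighbour regression on `d`-dimensional perspectives by
more than `τ`. -/
def misleadingData (r : ℕ) : Set (Fin (n + 1) → Draw F X M r) :=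
  {x | IsMisleading d τ (S.estDist Q x) fun i => S.score (x i).1 Finset.univ}

theorem measurable_expResponse : Measurable S.expResponse :=
  measurable_pi_lambda _ fun _ =>
    S.embed_measurable.stronglyMeasurable.integral_kernel.measurable

theorem measurable_meanResponse {r : ℕ} :
    Measurable fun x : Draw F X M r => S.meanResponse x := by
  have hembed := S.embed_measurable
  unfold meanResponse
  fun_prop

theorem measurableSet_misleadingModels : MeasurableSet (S.misleadingModels d Q τ n) := by
  have hresponse : Measurable fun (c : Fin (n + 1) → F) i => S.expResponse (c i) :=
    measurable_pi_lambda _ fun i => S.measurable_expResponse.comp (measurable_pi_apply i)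
  have hscore : Measurable fun (c : Fin (n + 1) → F) i => S.score (c i) Finset.univ :=
    measurable_pi_lambda _ fun i => (S.score_measurable _).comp (measurable_pi_apply i)
  exact (((continuous_frobDist Q).measurable.comp hresponse).prodMk hscore)
    (measurableSet_setOf_isMisleading d τ)

theorem measurableSet_misleadingData (r : ℕ) : MeasurableSet (S.misleadingData d Q τ n r) := by
  have hresponse : Measurable fun (x : Fin (n + 1) → Draw F X M r) i => S.meanResponse (x i) :=
    measurable_pi_lambda _ fun i => S.measurable_meanResponse.comp (measurable_pi_apply i)
  have hscore : Measurable fun (x : Fin (n + 1) → Draw F X M r) i =>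
      S.score (x i).1 Finset.univ :=
    measurable_pi_lambda _ fun i =>
      (S.score_measurable _).comp (measurable_fst.comp (measurable_pi_apply i))
  exact (((continuous_frobDist Q).measurable.comp hresponse).prodMk hscore)
    (measurableSet_setOf_isMisleading d τ)

end Misleading

variable {S} {d : ℕ} {Q : Finset (Fin M)} {τ : ℝ} {n : ℕ}

section Population

variable [PseudoMetricSpace F]

theorem FullSupport.measure_compl_ball_lt_one [OpensMeasurableSpace F] (hsupp : S.FullSupport)
    (f : F) {δ : ℝ} (hδ : 0 < δ) : S.modelLaw (Metric.ball f δ)ᶜ < 1 := by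
  obtain ⟨ε, hε, hle⟩ := hsupp f δ hδ
  have hball : S.modelLaw (Metric.ball f δ) ≠ 0 := fun h => by
    rw [Measure.real, h, ENNReal.toReal_zero] at hle
    exact hε.not_ge hle
  rw [prob_compl_eq_one_sub Metric.isOpen_ball.measurableSet]
  exact ENNReal.sub_lt_self ENNReal.one_ne_top one_ne_zero hball

theorem exists_le_dist_of_cons_mem_misleadingModels (hlip : S.LipschitzScore d Q)
    (hcont : S.PerspectiveContinuous d Q) (hτ : 0 < τ) (f : F) :
    ∃ δ : ℝ, 0 < δ ∧ ∀ (n : ℕ) (c : Fin n → F),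
      (Fin.cons f c : Fin (n + 1) → F) ∈ S.misleadingModels d Q τ n → ∀ k, δ ≤ dist (c k) f := by
  obtain ⟨γ, hγ, hlip⟩ := hlip
  obtain ⟨δ, hδ, hclose⟩ := hcont f (τ / γ) (div_pos hτ hγ)
  refine ⟨δ, hδ, ?_⟩
  rintro n c ⟨i, ⟨ψ, hnear, hψ⟩, hi⟩ k
  have hfar : τ / γ < ‖ψ k.succ - ψ 0‖ :=
    ((div_lt_iff₀' hγ).2 (hi.trans_le (hlip _ _ ψ hψ i.succ 0))).trans_le (hnear k)
  by_contra! hk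
  have hnot := hclose (c k) (by rwa [dist_comm]) _ _ ψ hψ 0 k.succ rfl rfl
  rw [norm_sub_rev] at hnot
  exact lt_asymm hfar hnot

variable [OpensMeasurableSpace F]

theorem tendsto_measure_cons_mem_misleadingModels (hsupp : S.FullSupport)
    (hlip : S.LipschitzScore d Q) (hcont : S.PerspectiveContinuous d Q) (hτ : 0 < τ) (f : F) :
    Tendsto (fun n => Measure.pi (fun _ : Fin n => S.modelLaw)
      {c | (Fin.cons f c : Fin (n + 1) → F) ∈ S.misleadingModels d Q τ n}) atTop (𝓝 0) := by
  obtain ⟨δ, hδ, hfar⟩ := exists_le_dist_of_cons_mem_misleadingModels hlip hcont hτ f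
  refine tendsto_of_tendsto_of_tendsto_of_le_of_le tendsto_const_nhds
    (ENNReal.tendsto_pow_atTop_nhds_zero_of_lt_one (hsupp.measure_compl_ball_lt_one f hδ))
    (fun _ => zero_le) fun n => ?_
  calc Measure.pi (fun _ : Fin n => S.modelLaw)
        {c | (Fin.cons f c : Fin (n + 1) → F) ∈ S.misleadingModels d Q τ n}
      ≤ Measure.pi (fun _ : Fin n => S.modelLaw) (Set.univ.pi fun _ => (Metric.ball f δ)ᶜ) :=
        measure_mono fun c hc k _ => not_lt.2 (hfar n c hc k)
    _ = S.modelLaw (Metric.ball f δ)ᶜ ^ n := by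
        rw [Measure.pi_pi, Finset.prod_const, Finset.card_univ, Fintype.card_fin]

theorem tendsto_measure_misleadingModels (hsupp : S.FullSupport) (hlip : S.LipschitzScore d Q)
    (hcont : S.PerspectiveContinuous d Q) (hτ : 0 < τ) :
    Tendsto (fun n => Measure.pi (fun _ : Fin (n + 1) => S.modelLaw)
      (S.misleadingModels d Q τ n)) atTop (𝓝 0) := by
  have hcons (n : ℕ) := measurePreserving_finCons fun _ : Fin (n + 1) => S.modelLaw
  have hmeas (n : ℕ) := (hcons n).measurable (S.measurableSet_misleadingModels d Q τ n)
  simp_rw [← fun n => (hcons n).measure_preimage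
    (S.measurableSet_misleadingModels d Q τ n).nullMeasurableSet, Measure.prod_apply (hmeas _)]
  rw [← lintegral_zero (μ := S.modelLaw)]
  exact tendsto_lintegral_of_dominated_convergence (fun _ => 1)
    (fun n => measurable_measure_prodMk_left (hmeas n))
    (fun _ => Eventually.of_forall fun _ => prob_le_one) (by simp)
    (Eventually.of_forall fun f =>
      tendsto_measure_cons_mem_misleadingModels hsupp hlip hcont hτ f)

end Population

section Sampling

theorem tendsto_measure_le_dist_meanResponse {f : F}
    (hint : ∀ j, Integrable S.embed (S.response j f)) {δ : ℝ} (hδ : 0 < δ) :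
    Tendsto (fun r => S.responseKernel r f
      {ω | δ ≤ dist (S.meanResponse (f, ω)) (S.expResponse f)}) atTop (𝓝 0) := by
  let P := Measure.infinitePi fun jk : Fin M × ℕ => S.response jk.1 f
  have hpres (r : ℕ) : MeasurePreserving
      (fun (ω : Fin M × ℕ → X) (jk : Fin M × Fin r) => ω (jk.1, jk.2)) P (S.responseKernel r f) :=
    measurePreserving_infinitePi_comp _ (Function.injective_id.prodMap Fin.val_injective)
  have hmeas (r : ℕ) : Measurable fun ω : Fin M × Fin r → X => S.meanResponse (f, ω) :=
    S.measurable_meanResponse.comp measurable_prodMk_left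
  have hlaw : ∀ᵐ ω ∂P, Tendsto
      (fun r => S.meanResponse (f, fun jk : Fin M × Fin r => ω (jk.1, jk.2))) atTop
      (𝓝 (S.expResponse f)) := by
    filter_upwards [ae_all_iff.2 fun j => ae_tendsto_average_infinitePi
      (fun j => S.response j f) j S.embed_measurable (hint j)] with ω hω
    exact tendsto_pi_nhds.2 hω
  have hprob := tendstoInMeasure_iff_dist.1 (tendstoInMeasure_of_tendsto_ae
    (fun r => ((hmeas r).comp (hpres r).measurable).aestronglyMeasurable) hlaw) δ hδ
  exact hprob.congr fun r => (hpres r).measure_preimage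
    (measurableSet_le measurable_const ((hmeas r).dist measurable_const)).nullMeasurableSet

theorem tendsto_measure_misleadingData_of_notMem {c : Fin (n + 1) → F}
    (hint : ∀ i j, Integrable S.embed (S.response j (c i)))
    (hc : c ∉ S.misleadingModels d Q τ n) :
    Tendsto (fun r => piKernel (fun _ => S.responseKernel r) c
      {ω | (fun i => (c i, ω i)) ∈ S.misleadingData d Q τ n r}) atTop (𝓝 0) := by
  have hclosed := (isClosed_setOf_isMisleading d τ fun i => S.score (c i) Finset.univ).preimage
    (continuous_frobDist (p := p) Q)
  obtain ⟨δ, hδ, hball⟩ := Metric.isOpen_iff.1 hclosed.isOpen_compl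
    (fun i => S.expResponse (c i)) hc
  have hfar (r : ℕ) : {ω : Fin (n + 1) → Fin M × Fin r → X |
      (fun i => (c i, ω i)) ∈ S.misleadingData d Q τ n r} ⊆
      {ω | ∃ i, ω i ∈ {ω | δ ≤ dist (S.meanResponse (c i, ω)) (S.expResponse (c i))}} := by
    intro ω hω
    by_contra hnear
    exact hball ((dist_pi_lt_iff hδ).2 fun i => not_le.1 fun hle => hnear ⟨i, hle⟩) hω
  refine tendsto_of_tendsto_of_tendsto_of_le_of_le tendsto_const_nhds ?_ (fun _ => zero_le)
    fun r => (measure_mono (hfar r)).trans (measure_pi_exists_mem_le _ _)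
  rw [← Finset.sum_const_zero (s := (Finset.univ : Finset (Fin (n + 1))))]
  exact tendsto_finsetSum _ fun i _ => tendsto_measure_le_dist_meanResponse (hint i) hδ

theorem limsup_trainLaw_misleadingData_le (hint : ∀ f j, Integrable S.embed (S.response j f)) :
    limsup (fun r => S.trainLaw (n + 1) r (S.misleadingData d Q τ n r)) atTop ≤
      Measure.pi (fun _ => S.modelLaw) (S.misleadingModels d Q τ n) := by
  have hpres (r : ℕ) := measurePreserving_pi_compProd (fun _ : Fin (n + 1) => S.responseKernel r)
    fun _ => S.modelLaw
  have hmeas (r : ℕ) := (hpres r).measurable (S.measurableSet_misleadingData d Q τ n r)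
  have hpoint (c : Fin (n + 1) → F) :
      limsup (fun r => piKernel (fun _ => S.responseKernel r) c
        {ω | (fun i => (c i, ω i)) ∈ S.misleadingData d Q τ n r}) atTop ≤
      (S.misleadingModels d Q τ n).indicator 1 c := by
    by_cases hc : c ∈ S.misleadingModels d Q τ n
    · rw [Set.indicator_of_mem hc]
      exact limsup_le_of_le (h := Eventually.of_forall fun _ => prob_le_one)
    · rw [Set.indicator_of_notMem hc]
      exact (tendsto_measure_misleadingData_of_notMem (fun i => hint (c i)) hc).limsup_eq.le
  calc limsup (fun r => S.trainLaw (n + 1) r (S.misleadingData d Q τ n r)) atTop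
      = limsup (fun r => ∫⁻ c, piKernel (fun _ => S.responseKernel r) c
          {ω | (fun i => (c i, ω i)) ∈ S.misleadingData d Q τ n r}
          ∂(Measure.pi fun _ => S.modelLaw)) atTop :=
        limsup_congr (Eventually.of_forall fun r => ((hpres r).measure_preimage
          (S.measurableSet_misleadingData d Q τ n r).nullMeasurableSet).symm.trans
            (Measure.compProd_apply (hmeas r)))
    _ ≤ ∫⁻ c, limsup (fun r => piKernel (fun _ => S.responseKernel r) c
          {ω | (fun i => (c i, ω i)) ∈ S.misleadingData d Q τ n r}) atTop
          ∂(Measure.pi fun _ => S.modelLaw) :=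
        limsup_lintegral_le (fun _ => 1) (fun r => Kernel.measurable_kernel_prodMk_left (hmeas r))
          (fun _ => Eventually.of_forall fun _ => prob_le_one) (by simp)
    _ ≤ ∫⁻ c, (S.misleadingModels d Q τ n).indicator 1 c ∂(Measure.pi fun _ => S.modelLaw) :=
        lintegral_mono hpoint
    _ = Measure.pi (fun _ => S.modelLaw) (S.misleadingModels d Q τ n) :=
        lintegral_indicator_one (S.measurableSet_misleadingModels d Q τ n)

end Sampling

section Risk

variable {psiHat : Finset (Fin M) → ∀ n r : ℕ,
  (Fin n → Draw F X M r) → Fin n → EuclideanSpace ℝ (Fin d)} {r : ℕ}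

theorem sqLoss_nnPredictor_le (hpsi : S.IsDKPS psiHat) (hn : 0 < n) (s : Fin n → Draw F X M r)
    (t : Draw F X M r) :
    sqLoss (S.nnPredictor psiHat Q n r s t) (S.score t.1 Finset.univ) ≤ τ ^ 2 +
      {t | (Fin.cons t s : Fin (n + 1) → Draw F X M r) ∈ S.misleadingData d Q τ n r}.indicator
        (fun _ => (1 : ℝ)) t := by
  rw [sqLoss, ← sq_abs]
  by_cases h : (Fin.cons t s : Fin (n + 1) → Draw F X M r) ∈ S.misleadingData d Q τ n r
  · have hpred : S.nnPredictor psiHat Q n r s t ∈ Set.Icc (0 : ℝ) 1 :=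
      nnPredict_mem (convex_Icc 0 1) hn fun i _ => S.score_mem _ _
    have hle : |S.nnPredictor psiHat Q n r s t - S.score t.1 Finset.univ| ≤ 1 :=
      Real.dist_le_of_mem_Icc_01 hpred (S.score_mem _ _)
    rw [Set.indicator_of_mem (by exact h)]
    exact (pow_le_one₀ (abs_nonneg _) hle).trans (le_add_of_nonneg_left (sq_nonneg τ))
  · have hnot : ¬ IsMisleading d τ (S.estDist Q (Fin.cons t s : Fin (n + 1) → Draw F X M r))
        fun i => S.score ((Fin.cons t s : Fin (n + 1) → Draw F X M r) i).1 Finset.univ := h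
    have hle : |S.nnPredictor psiHat Q n r s t - S.score t.1 Finset.univ| ≤ τ :=
      abs_nnPredict_sub_le_of_not_isMisleading hn hnot ((hpsi Q (n + 1) r).2 _)
    rw [Set.indicator_of_notMem (by exact h), add_zero]
    exact pow_le_pow_left₀ (abs_nonneg _) hle 2

theorem risk_nnPredictor_le (hpsi : S.IsDKPS psiHat) (hn : 0 < n) (s : Fin n → Draw F X M r) :
    S.risk sqLoss (S.nnPredictor psiHat Q) s ≤ τ ^ 2 + (S.drawLaw r).real
      {t | (Fin.cons t s : Fin (n + 1) → Draw F X M r) ∈ S.misleadingData d Q τ n r} := by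
  have hmeas : MeasurableSet
      {t | (Fin.cons t s : Fin (n + 1) → Draw F X M r) ∈ S.misleadingData d Q τ n r} :=
    (measurePreserving_finCons fun _ => S.drawLaw r).measurable.comp measurable_prodMk_right
      (S.measurableSet_misleadingData d Q τ n r)
  have hint := (integrable_const (1 : ℝ) (μ := S.drawLaw r)).indicator hmeas
  refine (integral_mono_of_nonneg (Eventually.of_forall fun t => sq_nonneg _)
    ((integrable_const (τ ^ 2)).add hint)
    (Eventually.of_forall fun t => sqLoss_nnPredictor_le hpsi hn s t)).trans_eq ?_
  simp_rw [Pi.add_apply]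
  rw [integral_add (integrable_const _) hint, integral_indicator_const _ hmeas]
  simp

theorem measure_lt_risk_nnPredictor_le (hpsi : S.IsDKPS psiHat) {ε : ℝ} (hτ : τ ^ 2 < ε)
    (hn : 0 < n) :
    S.trainLaw n r {s | ε < S.risk sqLoss (S.nnPredictor psiHat Q) s} ≤
      S.trainLaw (n + 1) r (S.misleadingData d Q τ n r) / ENNReal.ofReal (ε - τ ^ 2) := by
  have hcons := (measurePreserving_finCons fun _ : Fin (n + 1) => S.drawLaw r)
  have hmeas := hcons.measurable (S.measurableSet_misleadingData d Q τ n r)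
  have hjoint : S.trainLaw (n + 1) r (S.misleadingData d Q τ n r) =
      ∫⁻ s, S.drawLaw r {t | (Fin.cons t s : Fin (n + 1) → Draw F X M r) ∈
        S.misleadingData d Q τ n r} ∂(S.trainLaw n r) :=
    (hcons.measure_preimage
      (S.measurableSet_misleadingData d Q τ n r).nullMeasurableSet).symm.trans
        (Measure.prod_apply_symm hmeas)
  have hsub : {s | ε < S.risk sqLoss (S.nnPredictor psiHat Q) s} ⊆
      {s | ENNReal.ofReal (ε - τ ^ 2) ≤ S.drawLaw r
        {t | (Fin.cons t s : Fin (n + 1) → Draw F X M r) ∈ S.misleadingData d Q τ n r}} :=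
    fun s hs => ENNReal.ofReal_le_of_le_toReal
      (sub_le_iff_le_add'.2 ((le_of_lt hs).trans (risk_nnPredictor_le hpsi hn s)))
  rw [hjoint]
  exact (measure_mono hsub).trans (meas_ge_le_lintegral_div
    (measurable_measure_prodMk_right hmeas).aemeasurable
    (ENNReal.ofReal_pos.2 (sub_pos.2 hτ)).ne' ENNReal.ofReal_ne_top)

theorem risk_subsetPredictor (Q : Finset (Fin M)) (s : Fin n → Draw F X M r) :
    S.risk sqLoss (S.subsetPredictor Q) s = S.subsetMSE Q := by
  have hfst : (S.drawLaw r).map Prod.fst = S.modelLaw := Measure.fst_compProd _ _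
  have hmeas : Measurable fun f => (S.score f Q - S.score f Finset.univ) ^ 2 :=
    ((S.score_measurable Q).sub (S.score_measurable _)).pow_const 2
  rw [subsetMSE, ← hfst, integral_map measurable_fst.aemeasurable hmeas.aestronglyMeasurable]
  rfl

variable [PseudoMetricSpace F] [OpensMeasurableSpace F]

theorem withHighProbability_risk_nnPredictor_le
    (hint : ∀ f j, Integrable S.embed (S.response j f)) (hsupp : S.FullSupport)
    (hpsi : S.IsDKPS psiHat) (hlip : S.LipschitzScore d Q) (hcont : S.PerspectiveContinuous d Q)
    {ε : ℝ} (hε : 0 < ε) :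
    S.WithHighProbability fun _ _ s => S.risk sqLoss (S.nnPredictor psiHat Q) s ≤ ε := by
  intro η hη
  have hτ : 0 < √(ε / 2) := Real.sqrt_pos.2 (half_pos hε)
  have hsq : √(ε / 2) ^ 2 = ε / 2 := Real.sq_sqrt (half_pos hε).le
  have hbound : 0 < ENNReal.ofReal (η * (ε / 2)) :=
    ENNReal.ofReal_pos.2 (mul_pos hη (half_pos hε))
  obtain ⟨N, hN⟩ := eventually_atTop.1
    ((tendsto_measure_misleadingModels hsupp hlip hcont hτ).eventually_lt_const hbound)
  refine ⟨N, fun n hn => ?_⟩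
  obtain ⟨R, hR⟩ := eventually_atTop.1
    (eventually_lt_of_limsup_lt ((limsup_trainLaw_misleadingData_le hint).trans_lt (hN n hn.le)))
  refine ⟨R, fun r hr => ENNReal.toReal_le_of_le_ofReal hη.le ?_⟩
  simp_rw [not_le]
  calc S.trainLaw n r {s | ε < S.risk sqLoss (S.nnPredictor psiHat Q) s}
      ≤ S.trainLaw (n + 1) r (S.misleadingData d Q √(ε / 2) n r) /
          ENNReal.ofReal (ε - √(ε / 2) ^ 2) :=
        measure_lt_risk_nnPredictor_le hpsi (hsq.trans_lt (half_lt_self hε)) (Nat.zero_lt_of_lt hn)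
    _ ≤ ENNReal.ofReal (η * (ε / 2)) / ENNReal.ofReal (ε / 2) := by
        rw [hsq, sub_half]
        exact ENNReal.div_le_div_right (hR r hr).le _
    _ = ENNReal.ofReal η := by
        rw [← ENNReal.ofReal_div_of_pos (half_pos hε), mul_div_cancel_right₀ _ (half_pos hε).ne']

theorem qEfficient_nnPredictor
    (hint : ∀ f j, Integrable S.embed (S.response j f)) (hsupp : S.FullSupport)
    (hpsi : S.IsDKPS psiHat) (hlip : S.LipschitzScore d Q) (hcont : S.PerspectiveContinuous d Q)
    (hmse : 0 < S.subsetMSE Q) :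
    S.QEfficient sqLoss (S.nnPredictor psiHat Q) (S.subsetPredictor Q) := by
  simp only [QEfficient, risk_subsetPredictor]
  exact withHighProbability_risk_nnPredictor_le hint hsupp hpsi hlip hcont hmse

end Risk

end Setting

end DKPS

theorem theorem2_general {F X : Type*} [PseudoMetricSpace F] [MeasurableSpace F]
    [OpensMeasurableSpace F] [MeasurableSpace X] {M p d : ℕ} (S : DKPS.Setting F X M p)
    (hint : ∀ f j, Integrable S.embed (S.response j f)) (hsupp : S.FullSupport)
    (psiHat : Finset (Fin M) → ∀ n r : ℕ,
      (Fin n → DKPS.Draw F X M r) → Fin n → EuclideanSpace ℝ (Fin d))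
    (hpsi : S.IsDKPS psiHat) :
    (∀ Q : Finset (Fin M), S.LipschitzScore d Q → S.PerspectiveContinuous d Q →
      ∀ ε : ℝ, 0 < ε →
        S.WithHighProbability fun _ _ s =>
          S.risk DKPS.sqLoss (S.nnPredictor psiHat Q) s ≤ ε) ∧
    (∀ Q : Finset (Fin M), S.LipschitzScore d Q → S.PerspectiveContinuous d Q →
      0 < S.subsetMSE Q →
        S.QEfficient DKPS.sqLoss (S.nnPredictor psiHat Q) (S.subsetPredictor Q)) ∧
    (∀ m : ℕ, m < M →
      (∀ Q : Finset (Fin M), Q.card = m →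
        S.LipschitzScore d Q ∧ S.PerspectiveContinuous d Q ∧ 0 < S.subsetMSE Q) →
      S.MEfficient DKPS.sqLoss m (S.nnPredictor psiHat) S.subsetPredictor) ∧
    ((∀ Q : Finset (Fin M), 1 ≤ Q.card → Q.card < M →
        S.LipschitzScore d Q ∧ S.PerspectiveContinuous d Q ∧ 0 < S.subsetMSE Q) →
      S.QueryEfficient DKPS.sqLoss (S.nnPredictor psiHat) S.subsetPredictor) := by
  refine ⟨fun Q hlip hcont ε hε =>
      DKPS.Setting.withHighProbability_risk_nnPredictor_le hint hsupp hpsi hlip hcont hε,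
    fun Q hlip hcont hmse =>
      DKPS.Setting.qEfficient_nnPredictor hint hsupp hpsi hlip hcont hmse,
    fun m _ h Q hQ => ?_, fun h m hm hmM Q hQ => ?_⟩
  · obtain ⟨hlip, hcont, hmse⟩ := h Q hQ
    exact DKPS.Setting.qEfficient_nnPredictor hint hsupp hpsi hlip hcont hmse
  · obtain ⟨hlip, hcont, hmse⟩ := h Q (hQ ▸ hm) (hQ ▸ hmM)
    exact DKPS.Setting.qEfficient_nnPredictor hint hsupp hpsi hlip hcont hmse

theorem theorem2 {F X : Type*} [PseudoMetricSpace F] [MeasurableSpace F] [OpensMeasurableSpace F]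
    [MeasurableSpace X] {M p d : ℕ} (S : DKPS.Setting F X M p)
    (hmom : S.FiniteSecondMoment) (hsupp : S.FullSupport)
    (psiHat : Finset (Fin M) → ∀ n r : ℕ,
      (Fin n → DKPS.Draw F X M r) → Fin n → EuclideanSpace ℝ (Fin d))
    (hpsi : S.IsDKPS psiHat) :
    (∀ Q : Finset (Fin M), S.LipschitzScore d Q → S.PerspectiveContinuous d Q →
      ∀ ε : ℝ, 0 < ε →
        S.WithHighProbability fun _ _ s =>
          S.risk DKPS.sqLoss (S.nnPredictor psiHat Q) s ≤ ε) ∧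
    (∀ Q : Finset (Fin M), S.LipschitzScore d Q → S.PerspectiveContinuous d Q →
      0 < S.subsetMSE Q →
        S.QEfficient DKPS.sqLoss (S.nnPredictor psiHat Q) (S.subsetPredictor Q)) ∧
    (∀ m : ℕ, m < M →
      (∀ Q : Finset (Fin M), Q.card = m →
        S.LipschitzScore d Q ∧ S.PerspectiveContinuous d Q ∧ 0 < S.subsetMSE Q) →
      S.MEfficient DKPS.sqLoss m (S.nnPredictor psiHat) S.subsetPredictor) ∧
    ((∀ Q : Finset (Fin M), 1 ≤ Q.card → Q.card < M →
        S.LipschitzScore d Q ∧ S.PerspectiveContinuous d Q ∧ 0 < S.subsetMSE Q) →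
      S.QueryEfficient DKPS.sqLoss (S.nnPredictor psiHat) S.subsetPredictor) :=
  theorem2_general S (fun f j => (hmom f j).integrable one_le_two) hsupp psiHat hpsi
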